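/- Let $d\ge 2$ be an integer and let $\alpha\in\mathbb R$ satisfy either $\alpha=d-1$, or $\alpha<d$ and $\alpha\notin\mathbb Z$. Let $f\in\mathscr O_C'(\mathbb R^d)$ be a rapidly decreasing distribution, i.e. a (complex-valued) tempered distribution on $\mathbb R^d$ such that for every $k\in\mathbb N$ one can write $f=\sum_{i=1}^N\partial^{\beta_i}g_i$ as a finite sum of distributional derivatives of continuous functions $g_i$ with $\sup_{x}(1+|x|)^k|g_i(x)|<\infty$. Let $I_\alpha f=f*|\cdot|^{-\alpha}$ be its Riesz potential, the tempered distribution given by $$\langle I_\alpha f,\varphi\rangle=\int_{\mathbb R^d}|x|^{-\alpha}\,\langle f,\varphi(\cdot+x)\rangle\,dx\qquad(\varphi\in\mathscr S(\mathbb R^d)).$$ Let $V\subset\mathbb R^d$ be any nonempty open set. If $f|_V=0$ and $I_\alpha f|_V=0$ (as distributions on $V$), then $f=0$. -/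

import Mathlib

open MeasureTheory
open scoped SchwartzMap LineDeriv

/-- A tempered distribution `f` on `ℝᵈ` is rapidly decreasing (`f ∈ 𝒪_C'(ℝᵈ)`) if for every `k`
it is a finite sum of distributional derivatives `∂^β g` of continuous functions `g` such that
`(1 + |x|)^k g(x)` is bounded. The multi-index `β` is written as a finite sequence of coordinate
directions, and `⟨∂^β g, φ⟩ = (-1)^|β| ∫ g ∂^β φ`. -/
def IsRapidlyDecreasing {d : ℕ} (f : 𝓢'(EuclideanSpace ℝ (Fin d), ℂ)) : Prop :=
  ∀ k : ℕ, ∃ (N : ℕ) (n : Fin N → ℕ) (β : (i : Fin N) → Fin (n i) → Fin d)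
    (g : Fin N → EuclideanSpace ℝ (Fin d) → ℂ),
    (∀ i, Continuous (g i)) ∧
    (∀ i, ∃ C : ℝ, ∀ x, (1 + ‖x‖) ^ k * ‖g i x‖ ≤ C) ∧
    ∀ φ : 𝓢(EuclideanSpace ℝ (Fin d), ℂ),
      f φ = ∑ i, (-1 : ℂ) ^ n i *
        ∫ x, g i x * (∂^{fun j => EuclideanSpace.single (β i j) (1 : ℝ)} φ) x

/-- The distribution `f` vanishes on `V`: `⟨f, φ⟩ = 0` for every compactly supported smooth `φ`
with support in `V`. -/
def VanishesOn {d : ℕ} (f : 𝓢'(EuclideanSpace ℝ (Fin d), ℂ))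
    (V : Set (EuclideanSpace ℝ (Fin d))) : Prop :=
  ∀ φ : 𝓢(EuclideanSpace ℝ (Fin d), ℂ), HasCompactSupport φ → tsupport φ ⊆ V → f φ = 0

/-- The pairing `⟨f, φ(· + x)⟩`, i.e. the value at `x` of the convolution of `φ` with the
reflection of `f`. -/
noncomputable def pairTranslate {d : ℕ} (f : 𝓢'(EuclideanSpace ℝ (Fin d), ℂ))
    (φ : 𝓢(EuclideanSpace ℝ (Fin d), ℂ)) (x : EuclideanSpace ℝ (Fin d)) : ℂ :=
  f (φ.compSubConstCLM ℂ (-x))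

theorem iteratedLineDerivOp_compSubConstCLM {d n : ℕ} (m : Fin n → EuclideanSpace ℝ (Fin d))
    (φ : 𝓢(EuclideanSpace ℝ (Fin d), ℂ)) (x y : EuclideanSpace ℝ (Fin d)) :
    (∂^{m} (φ.compSubConstCLM ℂ (-x))) y = (∂^{m} φ) (y + x) := by
  rw [SchwartzMap.iteratedLineDerivOp_eq_iteratedFDeriv,
    SchwartzMap.iteratedLineDerivOp_eq_iteratedFDeriv]
  have : (φ.compSubConstCLM ℂ (-x) : EuclideanSpace ℝ (Fin d) → ℂ) = fun z => φ (z + x) := by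
    ext z; simp
  rw [this, iteratedFDeriv_comp_add_right]

theorem norm_iteratedLineDerivOp_le {d n : ℕ} (β : Fin n → Fin d) (K : ℕ)
    (φ : 𝓢(EuclideanSpace ℝ (Fin d), ℂ)) (x : EuclideanSpace ℝ (Fin d)) :
    (1 + ‖x‖) ^ K * ‖(∂^{fun j => EuclideanSpace.single (β j) (1 : ℝ)} φ) x‖ ≤
      2 ^ K * (Finset.Iic (K, n)).sup (schwartzSeminormFamily ℂ _ ℂ) φ := by
  refine le_trans ?_ (SchwartzMap.one_add_le_sup_seminorm_apply (𝕜 := ℂ) (m := (K, n))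
    le_rfl le_rfl φ x)
  gcongr
  rw [SchwartzMap.iteratedLineDerivOp_eq_iteratedFDeriv]
  refine (ContinuousMultilinearMap.le_opNorm _ _).trans ?_
  simp

/-- One summand of `⟨f, φ(· + x)⟩`: it is continuous in `x` and decays, with a bound by a Schwartz
seminorm of `φ`. -/
theorem term_bound {d n : ℕ} (β : Fin n → Fin d) (K : ℕ)
    {g : EuclideanSpace ℝ (Fin d) → ℂ} (hg : Continuous g) {C : ℝ}
    (hC : ∀ x, (1 + ‖x‖) ^ (K + d + 1) * ‖g x‖ ≤ C)  :
    (∀ φ : 𝓢(EuclideanSpace ℝ (Fin d), ℂ), Continuous fun x =>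
      ∫ y, g y * (∂^{fun j => EuclideanSpace.single (β j) (1 : ℝ)} φ) (y + x)) ∧
    ∃ D : ℝ, 0 ≤ D ∧ ∀ (φ : 𝓢(EuclideanSpace ℝ (Fin d), ℂ)) x, (1 + ‖x‖) ^ K *
      ‖∫ y, g y * (∂^{fun j => EuclideanSpace.single (β j) (1 : ℝ)} φ) (y + x)‖ ≤
      D * (Finset.Iic (K, n)).sup (schwartzSeminormFamily ℂ _ ℂ) φ := by
  have hC0 : 0 ≤ C := le_trans (by positivity) (hC 0)
  have hint : Integrable (fun y : EuclideanSpace ℝ (Fin d) => (1 + ‖y‖) ^ (-((d : ℝ) + 1))) := by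
    apply integrable_one_add_norm
    simp
  have key : ∀ (φ : 𝓢(EuclideanSpace ℝ (Fin d), ℂ)) (x y : EuclideanSpace ℝ (Fin d)),
      (1 + ‖x‖) ^ K *
      ‖g y * (∂^{fun j => EuclideanSpace.single (β j) (1 : ℝ)} φ) (y + x)‖ ≤
      (C * (2 ^ K * (Finset.Iic (K, n)).sup (schwartzSeminormFamily ℂ _ ℂ) φ)) *
        (1 + ‖y‖) ^ (-((d : ℝ) + 1)) := by
    intro φ x y
    have h1 := hC y
    have h2 := norm_iteratedLineDerivOp_le β K φ (y + x)
    have h3 : 1 + ‖x‖ ≤ (1 + ‖y‖) * (1 + ‖y + x‖) := by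
      have : ‖x‖ ≤ ‖y + x‖ + ‖y‖ := by
        calc ‖x‖ = ‖(y + x) - y‖ := by simp
          _ ≤ _ := norm_sub_le _ _
      nlinarith [norm_nonneg y, norm_nonneg (y + x)]
    have hpos : 0 < 1 + ‖y‖ := by positivity
    have e : (1 + ‖y‖) ^ (-((d : ℝ) + 1)) = ((1 + ‖y‖) ^ (d + 1))⁻¹ := by
      rw [Real.rpow_neg hpos.le]
      congr 1
      exact_mod_cast Real.rpow_natCast (1 + ‖y‖) (d + 1)
    rw [e, ← div_eq_mul_inv, le_div_iff₀ (by positivity), norm_mul]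
    calc _ ≤ ((1 + ‖y‖) * (1 + ‖y + x‖)) ^ K * (‖g y‖ *
            ‖(∂^{fun j => EuclideanSpace.single (β j) (1 : ℝ)} φ) (y + x)‖) *
            (1 + ‖y‖) ^ (d + 1) := by gcongr
      _ = ((1 + ‖y‖) ^ (K + d + 1) * ‖g y‖) * ((1 + ‖y + x‖) ^ K *
            ‖(∂^{fun j => EuclideanSpace.single (β j) (1 : ℝ)} φ) (y + x)‖) := by rw [mul_pow]; ring
      _ ≤ _ := by gcongr
  constructor
  · intro φ
    refine continuous_of_dominated (bound := fun y =>
      (C * (2 ^ K * (Finset.Iic (K, n)).sup (schwartzSeminormFamily ℂ _ ℂ) φ)) *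
        (1 + ‖y‖) ^ (-((d : ℝ) + 1))) ?_ ?_ (hint.const_mul _) ?_
    · intro x
      have := (∂^{fun j => EuclideanSpace.single (β j) (1 : ℝ)} φ).continuous
      exact Continuous.aestronglyMeasurable (by fun_prop)
    · intro x
      refine Filter.Eventually.of_forall fun y => le_trans ?_ (key φ x y)
      exact le_mul_of_one_le_left (norm_nonneg _) (one_le_pow₀ (by simp))
    · refine Filter.Eventually.of_forall fun y => ?_
      have := (∂^{fun j => EuclideanSpace.single (β j) (1 : ℝ)} φ).continuous
      fun_prop
  · refine ⟨C * 2 ^ K * ∫ y : EuclideanSpace ℝ (Fin d), (1 + ‖y‖) ^ (-((d : ℝ) + 1)),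
      by positivity, fun φ x => ?_⟩
    calc (1 + ‖x‖) ^ K *
          ‖∫ y, g y * (∂^{fun j => EuclideanSpace.single (β j) (1 : ℝ)} φ) (y + x)‖
        = ‖∫ y, ((1 + ‖x‖) ^ K : ℝ) •
            (g y * (∂^{fun j => EuclideanSpace.single (β j) (1 : ℝ)} φ) (y + x))‖ := by
          rw [integral_smul, norm_smul, Real.norm_of_nonneg (by positivity)]
      _ ≤ ∫ y, (C * (2 ^ K * (Finset.Iic (K, n)).sup (schwartzSeminormFamily ℂ _ ℂ) φ)) *
            (1 + ‖y‖) ^ (-((d : ℝ) + 1)) := by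
          refine norm_integral_le_of_norm_le (hint.const_mul _)
            (Filter.Eventually.of_forall fun y => ?_)
          rw [norm_smul, Real.norm_of_nonneg (by positivity)]
          exact key φ x y
      _ = _ := by rw [integral_const_mul]; ring

theorem pairTranslate_bound {d : ℕ} {f : 𝓢'(EuclideanSpace ℝ (Fin d), ℂ)}
    (hf : IsRapidlyDecreasing f) (K : ℕ) :
    (∀ φ, Continuous (pairTranslate f φ)) ∧
    ∃ (s : Finset (ℕ × ℕ)) (D : ℝ), 0 ≤ D ∧ ∀ φ x, (1 + ‖x‖) ^ K * ‖pairTranslate f φ x‖ ≤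
      D * s.sup (schwartzSeminormFamily ℂ _ ℂ) φ := by
  obtain ⟨N, n, β, g, hg, hC, hfg⟩ := hf (K + d + 1)
  choose C hC using hC
  have hb := fun i => term_bound (β i) K (hg i) (hC i)
  have hval : ∀ φ x, pairTranslate f φ x = ∑ i, (-1 : ℂ) ^ n i *
      ∫ y, g i y * (∂^{fun j => EuclideanSpace.single (β i j) (1 : ℝ)} φ) (y + x) := by
    intro φ x
    simp only [pairTranslate, hfg, iteratedLineDerivOp_compSubConstCLM]
  refine ⟨fun φ => ?_, ?_⟩
  · have : pairTranslate f φ = fun x => ∑ i, (-1 : ℂ) ^ n i *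
        ∫ y, g i y * (∂^{fun j => EuclideanSpace.single (β i j) (1 : ℝ)} φ) (y + x) :=
      funext (hval φ)
    rw [this]
    exact continuous_finsetSum _ fun i _ => continuous_const.mul ((hb i).1 φ)
  · choose D hD0 hD using fun i => (hb i).2
    refine ⟨Finset.univ.biUnion fun i => Finset.Iic (K, n i), ∑ i, D i,
      Finset.sum_nonneg fun i _ => hD0 i, fun φ x => ?_⟩
    rw [hval, Finset.sum_mul]
    calc _ ≤ (1 + ‖x‖) ^ K * ∑ i, ‖(-1 : ℂ) ^ n i * ∫ y, g i y *
            (∂^{fun j => EuclideanSpace.single (β i j) (1 : ℝ)} φ) (y + x)‖ := by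
          gcongr
          exact norm_sum_le _ _
      _ = ∑ i, (1 + ‖x‖) ^ K * ‖∫ y, g i y *
            (∂^{fun j => EuclideanSpace.single (β i j) (1 : ℝ)} φ) (y + x)‖ := by
          simp [Finset.mul_sum]
      _ ≤ _ := by
          refine Finset.sum_le_sum fun i _ => (hD i φ x).trans ?_
          refine mul_le_mul_of_nonneg_left ?_ (hD0 i)
          refine Seminorm.le_def.1 (Finset.sup_mono ?_) φ
          exact Finset.subset_biUnion_of_mem (fun i => Finset.Iic (K, n i)) (Finset.mem_univ i)

/-- The Riesz kernel `|x|^{-α}`. -/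
noncomputable def rieszKernel {d : ℕ} (α : ℝ) (x : EuclideanSpace ℝ (Fin d)) : ℝ :=
  ‖x‖ ^ (-α)

theorem integrable_rieszKernel_mul {d : ℕ} {α : ℝ} (hα : α < d) : ∃ K : ℕ,
    Integrable fun x : EuclideanSpace ℝ (Fin d) => rieszKernel α x * ((1 + ‖x‖) ^ K)⁻¹ := by
  rcases Nat.eq_zero_or_pos d with rfl | hd
  · exact ⟨0, Integrable.of_finite⟩
  refine ⟨⌈|α|⌉₊ + d + 1, ?_⟩
  set K := ⌈|α|⌉₊ + d + 1
  have hm : Measurable fun x : EuclideanSpace ℝ (Fin d) =>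
      rieszKernel α x * ((1 + ‖x‖) ^ K)⁻¹ := by
    unfold rieszKernel
    fun_prop
  rw [← integrableOn_univ, ← Set.union_compl_self (Metric.ball 0 1)]
  refine IntegrableOn.union ?_ ?_
  · refine integrableOn_ball_of_norm_le_rpow (C := 1) (α := α) (by rw [finrank_euclideanSpace_fin]; exact hd)
      (by simpa using hα) ?_ hm.aestronglyMeasurable
    refine Filter.Eventually.of_forall fun x => ?_
    have h0 : 0 ≤ ‖x‖ ^ (-α) := by positivity
    rw [rieszKernel, norm_mul, Real.norm_of_nonneg h0, Real.norm_of_nonneg (by positivity), one_mul]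
    exact mul_le_of_le_one_right h0 (inv_le_one_of_one_le₀ (one_le_pow₀ (by simp)))
  · have hint : Integrable
        (fun y : EuclideanSpace ℝ (Fin d) => (1 + ‖y‖) ^ (-((d : ℝ) + 1))) := by
      apply integrable_one_add_norm
      simp
    refine Integrable.mono' hint.integrableOn hm.aestronglyMeasurable ?_
    refine (ae_restrict_iff' measurableSet_ball.compl).2 (Filter.Eventually.of_forall fun x hx => ?_)
    have hx1 : 1 ≤ ‖x‖ := by simpa using hx
    have h0 : 0 ≤ ‖x‖ ^ (-α) := by positivity
    have hpos : 0 < 1 + ‖x‖ := by positivity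
    rw [rieszKernel, norm_mul, Real.norm_of_nonneg h0, Real.norm_of_nonneg (by positivity)]
    calc ‖x‖ ^ (-α) * ((1 + ‖x‖) ^ K)⁻¹
        ≤ (1 + ‖x‖) ^ (⌈|α|⌉₊ : ℝ) * ((1 + ‖x‖) ^ K)⁻¹ := by
          gcongr
          calc ‖x‖ ^ (-α) ≤ ‖x‖ ^ (⌈|α|⌉₊ : ℝ) :=
                Real.rpow_le_rpow_of_exponent_le hx1 ((neg_le_abs α).trans (Nat.le_ceil _))
            _ ≤ _ := by gcongr; linarith
      _ = (1 + ‖x‖) ^ (-((d : ℝ) + 1)) := by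
          rw [← Real.rpow_natCast (1 + ‖x‖) K, ← Real.rpow_neg hpos.le, ← Real.rpow_add hpos]
          congr 1
          simp only [K]
          push_cast
          ring

/-- The integral defining the Riesz potential converges absolutely. -/
theorem integrable_rieszKernel_mul_pairTranslate {d : ℕ} {α : ℝ} (hα : α < d)
    {f : 𝓢'(EuclideanSpace ℝ (Fin d), ℂ)} (hf : IsRapidlyDecreasing f)
    (φ : 𝓢(EuclideanSpace ℝ (Fin d), ℂ)) :
    Integrable fun x => (rieszKernel α x : ℂ) * pairTranslate f φ x := by
  obtain ⟨K, hK⟩ := integrable_rieszKernel_mul hα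
  obtain ⟨hc, s, D, hD0, hD⟩ := pairTranslate_bound hf K
  refine Integrable.mono' (hK.const_mul (D * s.sup (schwartzSeminormFamily ℂ _ ℂ) φ)) ?_
    (Filter.Eventually.of_forall fun x => ?_)
  · have : Measurable (rieszKernel α : EuclideanSpace ℝ (Fin d) → ℝ) := by
      unfold rieszKernel
      fun_prop
    exact (Complex.measurable_ofReal.comp this).aestronglyMeasurable.mul
      (hc φ).aestronglyMeasurable
  · have h0 : 0 ≤ rieszKernel α x := by unfold rieszKernel; positivity
    have hp : 0 < (1 + ‖x‖) ^ K := by positivity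
    have h1 : ‖pairTranslate f φ x‖ ≤
        D * s.sup (schwartzSeminormFamily ℂ _ ℂ) φ * ((1 + ‖x‖) ^ K)⁻¹ := by
      rw [← div_eq_mul_inv, le_div_iff₀ hp, mul_comm]
      exact hD φ x
    rw [norm_mul, Complex.norm_real, Real.norm_of_nonneg h0]
    calc _ ≤ rieszKernel α x *
          (D * s.sup (schwartzSeminormFamily ℂ _ ℂ) φ * ((1 + ‖x‖) ^ K)⁻¹) := by gcongr
      _ = _ := by ring

/-- The Riesz potential `I_α f = f * |·|^{-α}` of a rapidly decreasing distribution `f`, for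
`α < d`, as a tempered distribution: the convolution of distributions,
`⟨f * k, φ⟩ = ∫ k(x) ⟨f, φ(· + x)⟩ dx` with `k(x) = |x|^{-α}`. -/
noncomputable def rieszPotential {d : ℕ} {α : ℝ} (hα : α < d)
    (f : 𝓢'(EuclideanSpace ℝ (Fin d), ℂ)) (hf : IsRapidlyDecreasing f) :
    𝓢'(EuclideanSpace ℝ (Fin d), ℂ) :=
  ContinuousLinearMap.toPointwiseConvergenceCLM _ _ _ _ <|
    SchwartzMap.mkCLMtoNormedSpace (𝕜 := ℂ) (σ := RingHom.id ℂ)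
    (fun φ => ∫ x, (rieszKernel α x : ℂ) * pairTranslate f φ x)
    (fun φ ψ => by
      rw [← integral_add (integrable_rieszKernel_mul_pairTranslate hα hf φ)
        (integrable_rieszKernel_mul_pairTranslate hα hf ψ)]
      congr 1
      ext x
      simp [pairTranslate, mul_add])
    (fun a φ => by
      rw [RingHom.id_apply, ← integral_smul]
      congr 1
      ext x
      simp [pairTranslate, mul_left_comm])
    (by
      obtain ⟨K, hK⟩ := integrable_rieszKernel_mul hα
      obtain ⟨hc, s, D, hD0, hD⟩ := pairTranslate_bound hf K
      refine ⟨s, D * ∫ x : EuclideanSpace ℝ (Fin d), rieszKernel α x * ((1 + ‖x‖) ^ K)⁻¹, ?_, ?_⟩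
      · refine mul_nonneg hD0 (integral_nonneg fun x => ?_)
        simp only [rieszKernel, Pi.zero_apply]
        positivity
      · intro φ
        calc _ ≤ ∫ x : EuclideanSpace ℝ (Fin d),
              D * s.sup (schwartzSeminormFamily ℂ _ ℂ) φ *
                (rieszKernel α x * ((1 + ‖x‖) ^ K)⁻¹) := by
              refine norm_integral_le_of_norm_le (hK.const_mul _)
                (Filter.Eventually.of_forall fun x => ?_)
              have h0 : 0 ≤ rieszKernel α x := by unfold rieszKernel; positivity
              have hp : 0 < (1 + ‖x‖) ^ K := by positivity
              have h1 : ‖pairTranslate f φ x‖ ≤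
                  D * s.sup (schwartzSeminormFamily ℂ _ ℂ) φ * ((1 + ‖x‖) ^ K)⁻¹ := by
                rw [← div_eq_mul_inv, le_div_iff₀ hp, mul_comm]
                exact hD φ x
              rw [norm_mul, Complex.norm_real, Real.norm_of_nonneg h0]
              calc _ ≤ rieszKernel α x *
                    (D * s.sup (schwartzSeminormFamily ℂ _ ℂ) φ * ((1 + ‖x‖) ^ K)⁻¹) := by gcongr
                _ = _ := by ring
          _ = _ := by rw [integral_const_mul]; ring)

theorem rieszPotential_apply {d : ℕ} {α : ℝ} (hα : α < d)
    (f : 𝓢'(EuclideanSpace ℝ (Fin d), ℂ)) (hf : IsRapidlyDecreasing f)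
    (φ : 𝓢(EuclideanSpace ℝ (Fin d), ℂ)) :
    rieszPotential hα f hf φ = ∫ x, (rieszKernel α x : ℂ) * pairTranslate f φ x :=
  rfl

/-!
The distribution `f` is replaced by its mollifications `F(x) = ⟨f, ψ(· + x)⟩`, with `ψ` a test
function supported in a small ball around a point of `V`. Such an `F` is continuous and decays
faster than any power of `|x|`; both `F` and `z ↦ ∫ |x - z|^{-α} F(x) dx` vanish near the origin.

Since `F` vanishes near the origin, the second function may be differentiated under the integral
sign there. Applying the Laplacian repeatedly, with `Δ |x|^{-s} = s (s + 2 - d) |x|^{-s-2}`, turns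
`α` into `α + 2j` (`MomentVanishes.one_add_two`), and first derivatives then produce every kernel
`x^m |x|^{-α-2j}` with `|m| ≤ j` (`MomentVanishes.monomial`). The factors `α + 2j` and
`α + 2j + 2 - d` by which one divides are nonzero by the hypothesis on `α`. With
`j = |m|` these kernels are `|x|^{-α}` times the monomials in the inverted variable
`u = x / |x|²`, which ranges over a bounded set on the support of `F`. By the Stone–Weierstrass
theorem the integrable function `|x|^{-α} F(x)` is orthogonal to all test functions supported away
from the origin, so `F = 0` (`IsRapidlyDecaying.eq_zero`).

Finally `f = 0`, because `∫ ψ(x) ⟨f, χ(· - x)⟩ dx` equals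
`∫ χ(-x) ⟨f, ψ(· + x)⟩ dx = 0` for every Schwartz function `χ` and every such `ψ`
(`integral_mul_pairTranslate`, `eq_zero_of_pairTranslate_eq_zero`).
-/

/-! ### The kernels `p(w) |w|^{-s}` -/

/-- The kernel `p(w) |w|^{-s}` on `ℝᵈ`, for a polynomial `p` and a real exponent `s`. -/
noncomputable def polyKernel {d : ℕ} (p : MvPolynomial (Fin d) ℝ) (s : ℝ)
    (w : EuclideanSpace ℝ (Fin d)) : ℝ :=
  MvPolynomial.eval (fun i => w i) p * ‖w‖ ^ (-s)

theorem continuous_eval_euclidean {d : ℕ} (p : MvPolynomial (Fin d) ℝ) :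
    Continuous fun w : EuclideanSpace ℝ (Fin d) => MvPolynomial.eval (fun i => w i) p :=
  (MvPolynomial.continuous_eval p).comp (by fun_prop)

theorem measurable_polyKernel {d : ℕ} (p : MvPolynomial (Fin d) ℝ) (s : ℝ) :
    Measurable (polyKernel p s) := by
  have := (continuous_eval_euclidean p).measurable
  unfold polyKernel
  fun_prop

theorem hasDerivAt_eval_sub_smul_single {d : ℕ} (p : MvPolynomial (Fin d) ℝ) (i : Fin d)
    (v : EuclideanSpace ℝ (Fin d)) (t : ℝ) :
    HasDerivAt (fun t : ℝ =>
        MvPolynomial.eval (fun j => (v - t • EuclideanSpace.single i (1 : ℝ)) j) p)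
      (-MvPolynomial.eval (fun j => (v - t • EuclideanSpace.single i (1 : ℝ)) j)
        (MvPolynomial.pderiv i p)) t := by
  induction p using MvPolynomial.induction_on with
  | C a => simpa using hasDerivAt_const t a
  | add p q hp hq =>
    simp only [map_add, neg_add]
    exact hp.add hq
  | mul_X p j hp =>
    have hX : HasDerivAt (fun t : ℝ => (v - t • EuclideanSpace.single i (1 : ℝ)) j)
        (-(Pi.single (M := fun _ => ℝ) i (1 : ℝ) j)) t := by
      have := ((hasDerivAt_id t).mul_const (Pi.single (M := fun _ => ℝ) i (1 : ℝ) j)).const_sub (v j)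
      simpa [Pi.single_apply] using this
    simp only [map_mul, MvPolynomial.eval_X, MvPolynomial.pderiv_mul, MvPolynomial.pderiv_X,
      map_add]
    refine (hp.fun_mul hX).congr_deriv ?_
    by_cases h : j = i
    · subst h
      simp only [Pi.single_eq_same, map_one]
      ring
    · simp only [Pi.single_eq_of_ne h, map_zero]
      ring

theorem hasDerivAt_polyKernel {d : ℕ} (p : MvPolynomial (Fin d) ℝ) (s : ℝ) (i : Fin d)
    (v : EuclideanSpace ℝ (Fin d)) (t : ℝ) (hv : v - t • EuclideanSpace.single i (1 : ℝ) ≠ 0) :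
    HasDerivAt (fun t : ℝ => polyKernel p s (v - t • EuclideanSpace.single i (1 : ℝ)))
      (s * polyKernel (MvPolynomial.X i * p) (s + 2) (v - t • EuclideanSpace.single i (1 : ℝ)) -
        polyKernel (MvPolynomial.pderiv i p) s (v - t • EuclideanSpace.single i (1 : ℝ))) t := by
  have hw : HasDerivAt (fun t : ℝ => v - t • EuclideanSpace.single i (1 : ℝ))
      (-EuclideanSpace.single i (1 : ℝ)) t := by
    simpa using ((hasDerivAt_id t).smul_const (EuclideanSpace.single i (1 : ℝ))).const_sub v
  have hn := hw.norm_sq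
  have hpos : 0 < ‖v - t • EuclideanSpace.single i (1 : ℝ)‖ := norm_pos_iff.2 hv
  have hr := hn.rpow_const (p := -s / 2) (Or.inl (by positivity))
  have hnorm : ∀ (a b : ℝ), 0 ≤ a → (a ^ 2) ^ (b / 2) = a ^ b := by
    intro a b ha
    rw [← Real.rpow_natCast, ← Real.rpow_mul ha]
    congr 1
    push_cast
    ring
  have e : ∀ a : ℝ, -a / 2 - 1 = (-(a + 2)) / 2 := fun a => by ring
  simp only [hnorm _ _ (norm_nonneg _), e] at hr
  have := (hasDerivAt_eval_sub_smul_single p i v t).fun_mul hr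
  unfold polyKernel
  refine this.congr_deriv ?_
  simp only [map_mul, MvPolynomial.eval_X, inner_neg_right, EuclideanSpace.inner_single_right]
  simp
  ring

theorem exists_abs_eval_le {d : ℕ} (p : MvPolynomial (Fin d) ℝ) :
    ∃ (C : ℝ) (M : ℕ), 0 ≤ C ∧ ∀ w : EuclideanSpace ℝ (Fin d),
      |MvPolynomial.eval (fun i => w i) p| ≤ C * (1 + ‖w‖) ^ M := by
  induction p using MvPolynomial.induction_on with
  | C a => exact ⟨|a|, 0, abs_nonneg a, by simp⟩
  | add p q hp hq =>
    obtain ⟨C, M, hC, h⟩ := hp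
    obtain ⟨C', M', hC', h'⟩ := hq
    refine ⟨C + C', M + M', by positivity, fun w => ?_⟩
    have h1 : (1 : ℝ) ≤ 1 + ‖w‖ := by simp
    rw [map_add, add_mul]
    refine (abs_add_le _ _).trans (add_le_add ((h w).trans ?_) ((h' w).trans ?_))
    · gcongr
      omega
    · gcongr
      omega
  | mul_X p j hp =>
    obtain ⟨C, M, hC, h⟩ := hp
    refine ⟨C, M + 1, hC, fun w => ?_⟩
    rw [map_mul, MvPolynomial.eval_X, abs_mul, pow_succ, ← mul_assoc]
    have : |w j| ≤ ‖w‖ := PiLp.norm_apply_le w j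
    gcongr
    · exact h w
    · linarith

/-- Away from the origin, `p(w) |w|^{-s}` grows at most polynomially. -/
theorem exists_abs_polyKernel_le {d : ℕ} (p : MvPolynomial (Fin d) ℝ) (s : ℝ) {δ : ℝ}
    (hδ : 0 < δ) :
    ∃ (C : ℝ) (M : ℕ), 0 ≤ C ∧ ∀ w : EuclideanSpace ℝ (Fin d), δ ≤ ‖w‖ →
      |polyKernel p s w| ≤ C * (1 + ‖w‖) ^ M := by
  obtain ⟨C, M, hC, h⟩ := exists_abs_eval_le p
  refine ⟨C * (δ ^ (-s) * (δ ^ ⌈|s|⌉₊)⁻¹), M + ⌈|s|⌉₊, by positivity, fun w hw => ?_⟩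
  have hr : ‖w‖ ^ (-s) ≤ δ ^ (-s) * (δ ^ ⌈|s|⌉₊)⁻¹ * (1 + ‖w‖) ^ ⌈|s|⌉₊ := by
    have h1 : 1 ≤ ‖w‖ / δ := by rwa [one_le_div hδ]
    calc ‖w‖ ^ (-s) = δ ^ (-s) * (‖w‖ / δ) ^ (-s) := by
          rw [← Real.mul_rpow hδ.le (by positivity)]
          congr 1
          field_simp
      _ ≤ δ ^ (-s) * (‖w‖ / δ) ^ (⌈|s|⌉₊ : ℝ) := by
          gcongr
          exact (neg_le_abs s).trans (Nat.le_ceil _)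
      _ = δ ^ (-s) * (δ ^ ⌈|s|⌉₊)⁻¹ * ‖w‖ ^ ⌈|s|⌉₊ := by
          rw [Real.rpow_natCast, div_pow]
          ring
      _ ≤ _ := by gcongr; linarith
  rw [polyKernel, abs_mul, abs_of_nonneg (Real.rpow_nonneg (norm_nonneg w) _), pow_add]
  calc _ ≤ (C * (1 + ‖w‖) ^ M) * (δ ^ (-s) * (δ ^ ⌈|s|⌉₊)⁻¹ * (1 + ‖w‖) ^ ⌈|s|⌉₊) := by
        gcongr
        exact h w
    _ = _ := by ring

/-! ### Rapidly decaying functions and differentiation under the integral sign -/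

/-- `F` is continuous and decays faster than any power of `|x|`. -/
structure IsRapidlyDecaying {d : ℕ} (F : EuclideanSpace ℝ (Fin d) → ℂ) : Prop where
  continuous : Continuous F
  decay : ∀ K : ℕ, ∃ C : ℝ, ∀ x, (1 + ‖x‖) ^ K * ‖F x‖ ≤ C

theorem integrable_of_one_add_norm_pow_mul_le {d : ℕ} {G : Type*} [NormedAddCommGroup G]
    {g : EuclideanSpace ℝ (Fin d) → G} (hg : Continuous g) {C : ℝ}
    (hC : ∀ x, (1 + ‖x‖) ^ (d + 1) * ‖g x‖ ≤ C) : Integrable g := by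
  have hint : Integrable (fun y : EuclideanSpace ℝ (Fin d) => (1 + ‖y‖) ^ (-((d : ℝ) + 1))) := by
    apply integrable_one_add_norm
    simp
  refine (hint.const_mul C).mono' hg.aestronglyMeasurable
    (Filter.Eventually.of_forall fun x => ?_)
  have hpos : 0 < 1 + ‖x‖ := by positivity
  have e : (1 + ‖x‖) ^ (-((d : ℝ) + 1)) = ((1 + ‖x‖) ^ (d + 1))⁻¹ := by
    rw [Real.rpow_neg hpos.le]
    congr 1
    exact_mod_cast Real.rpow_natCast (1 + ‖x‖) (d + 1)
  rw [e, ← div_eq_mul_inv, le_div_iff₀ (by positivity), mul_comm]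
  exact hC x

theorem IsRapidlyDecaying.integrable_pow_mul_norm {d : ℕ} {F : EuclideanSpace ℝ (Fin d) → ℂ}
    (hF : IsRapidlyDecaying F) (K : ℕ) : Integrable fun x => (1 + ‖x‖) ^ K * ‖F x‖ := by
  obtain ⟨C, hC⟩ := hF.decay (K + (d + 1))
  have := hF.continuous
  refine integrable_of_one_add_norm_pow_mul_le (C := C) (by fun_prop) fun x => ?_
  refine le_trans (le_of_eq ?_) (hC x)
  rw [Real.norm_of_nonneg (by positivity), pow_add]
  ring

/-- If `F` vanishes near the origin, then for `z` close to the origin the kernel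
`polyKernel p s (x - z)` times `F x` has an integrable bound independent of `z`. -/
theorem IsRapidlyDecaying.exists_bound {d : ℕ} {F : EuclideanSpace ℝ (Fin d) → ℂ}
    (hF : IsRapidlyDecaying F) {ρ : ℝ} (hρ : 0 < ρ) (hF0 : ∀ x, ‖x‖ < 2 * ρ → F x = 0)
    (p : MvPolynomial (Fin d) ℝ) (s : ℝ) :
    ∃ B : EuclideanSpace ℝ (Fin d) → ℝ, Integrable B ∧ ∀ x z, ‖z‖ < ρ →
      ‖polyKernel p s (x - z) • F x‖ ≤ B x := by
  obtain ⟨C, M, hC, h⟩ := exists_abs_polyKernel_le p s hρ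
  refine ⟨fun x => C * (1 + ρ) ^ M * ((1 + ‖x‖) ^ M * ‖F x‖),
    (hF.integrable_pow_mul_norm M).const_mul _, fun x z hz => ?_⟩
  rcases lt_or_ge ‖x‖ (2 * ρ) with hx | hx
  · simp [hF0 x hx]
  have h1 : ρ ≤ ‖x - z‖ := by
    have := norm_sub_norm_le x z
    linarith
  have h2 : 1 + ‖x - z‖ ≤ (1 + ρ) * (1 + ‖x‖) := by
    have := norm_sub_le x z
    nlinarith [norm_nonneg x]
  rw [norm_smul, Real.norm_eq_abs]
  calc _ ≤ C * (1 + ‖x - z‖) ^ M * ‖F x‖ := by gcongr; exact h _ h1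
    _ ≤ C * ((1 + ρ) * (1 + ‖x‖)) ^ M * ‖F x‖ := by gcongr
    _ = _ := by rw [mul_pow]; ring

theorem IsRapidlyDecaying.integrable_polyKernel_smul {d : ℕ} {F : EuclideanSpace ℝ (Fin d) → ℂ}
    (hF : IsRapidlyDecaying F) {ρ : ℝ} (hρ : 0 < ρ) (hF0 : ∀ x, ‖x‖ < 2 * ρ → F x = 0)
    (p : MvPolynomial (Fin d) ℝ) (s : ℝ) {z : EuclideanSpace ℝ (Fin d)} (hz : ‖z‖ < ρ) :
    Integrable fun x => polyKernel p s (x - z) • F x := by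
  obtain ⟨B, hB, h⟩ := hF.exists_bound hρ hF0 p s
  refine hB.mono' ?_ (Filter.Eventually.of_forall fun x => h x z hz)
  exact ((measurable_polyKernel p s).comp (measurable_id.sub_const z)).aestronglyMeasurable.smul
    hF.continuous.aestronglyMeasurable

/-- The convolution of `F` with `p(-w) |w|^{-s}` vanishes on the ball of radius `ρ`. -/
def MomentVanishes {d : ℕ} (F : EuclideanSpace ℝ (Fin d) → ℂ) (ρ : ℝ)
    (p : MvPolynomial (Fin d) ℝ) (s : ℝ) : Prop :=
  ∀ z : EuclideanSpace ℝ (Fin d), ‖z‖ < ρ → ∫ x, polyKernel p s (x - z) • F x = 0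

/-- Differentiation under the integral sign in the direction of the `i`-th coordinate. -/
theorem MomentVanishes.deriv {d : ℕ} {F : EuclideanSpace ℝ (Fin d) → ℂ}
    (hF : IsRapidlyDecaying F) {ρ : ℝ} (hρ : 0 < ρ) (hF0 : ∀ x, ‖x‖ < 2 * ρ → F x = 0)
    {p : MvPolynomial (Fin d) ℝ} {s : ℝ} (h : MomentVanishes F ρ p s) (i : Fin d)
    {z : EuclideanSpace ℝ (Fin d)} (hz : ‖z‖ < ρ) :
    s • ∫ x, polyKernel (MvPolynomial.X i * p) (s + 2) (x - z) • F x =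
      ∫ x, polyKernel (MvPolynomial.pderiv i p) s (x - z) • F x := by
  obtain ⟨B₁, hB₁, h₁⟩ := hF.exists_bound hρ hF0 (MvPolynomial.X i * p) (s + 2)
  obtain ⟨B₂, hB₂, h₂⟩ := hF.exists_bound hρ hF0 (MvPolynomial.pderiv i p) s
  have hzt : ∀ t ∈ Metric.ball (0 : ℝ) (ρ - ‖z‖),
      ‖z + t • EuclideanSpace.single i (1 : ℝ)‖ < ρ := by
    intro t ht
    have ht' : |t| < ρ - ‖z‖ := by simpa using ht
    calc _ ≤ ‖z‖ + ‖t • EuclideanSpace.single i (1 : ℝ)‖ := norm_add_le _ _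
      _ = ‖z‖ + |t| := by simp [norm_smul]
      _ < ρ := by linarith
  have hs : Metric.ball (0 : ℝ) (ρ - ‖z‖) ∈ nhds (0 : ℝ) :=
    Metric.ball_mem_nhds _ (by linarith)
  have hsub : ∀ (t : ℝ) (x : EuclideanSpace ℝ (Fin d)),
      x - (z + t • EuclideanSpace.single i (1 : ℝ)) =
        x - z - t • EuclideanSpace.single i (1 : ℝ) := fun t x => by abel
  have hI₁ := hF.integrable_polyKernel_smul hρ hF0 (MvPolynomial.X i * p) (s + 2) hz
  have hI₂ := hF.integrable_polyKernel_smul hρ hF0 (MvPolynomial.pderiv i p) s hz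
  have key := hasDerivAt_integral_of_dominated_loc_of_deriv_le (μ := volume) (x₀ := (0 : ℝ))
    (F := fun t x => polyKernel p s (x - z - t • EuclideanSpace.single i (1 : ℝ)) • F x)
    (F' := fun t x => (s * polyKernel (MvPolynomial.X i * p) (s + 2)
        (x - z - t • EuclideanSpace.single i (1 : ℝ)) -
        polyKernel (MvPolynomial.pderiv i p) s
          (x - z - t • EuclideanSpace.single i (1 : ℝ))) • F x)
    (bound := fun x => |s| * B₁ x + B₂ x) hs ?_ ?_ ?_ ?_ ?_ ?_
  · have h0 : (fun t : ℝ => ∫ x,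
        polyKernel p s (x - z - t • EuclideanSpace.single i (1 : ℝ)) • F x) =ᶠ[nhds 0]
        fun _ => 0 := by
      filter_upwards [hs] with t ht
      simpa only [hsub] using h _ (hzt t ht)
    have := (key.2.congr_of_eventuallyEq h0.symm).unique (hasDerivAt_const (0 : ℝ) (0 : ℂ))
    simp only [zero_smul, sub_zero, sub_smul, mul_smul] at this
    rw [integral_sub (hI₁.fun_smul s) hI₂, sub_eq_zero, integral_smul] at this
    exact this
  · filter_upwards [hs] with t ht
    simpa only [hsub] using
      (hF.integrable_polyKernel_smul hρ hF0 p s (hzt t ht)).aestronglyMeasurable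
  · simpa using hF.integrable_polyKernel_smul hρ hF0 p s hz
  · simp only [zero_smul, sub_zero, sub_smul, mul_smul]
    exact ((hI₁.smul s).sub hI₂).aestronglyMeasurable
  · refine Filter.Eventually.of_forall fun x t ht => ?_
    have b₁ := h₁ x _ (hzt t ht)
    have b₂ := h₂ x _ (hzt t ht)
    rw [hsub] at b₁ b₂
    rw [sub_smul, mul_smul]
    refine (norm_sub_le _ _).trans (add_le_add ?_ b₂)
    rw [norm_smul, Real.norm_eq_abs]
    gcongr
  · exact (hB₁.const_mul _).add hB₂
  · refine Filter.Eventually.of_forall fun x t ht => ?_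
    rcases lt_or_ge ‖x‖ (2 * ρ) with hx | hx
    · simpa [hF0 x hx] using hasDerivAt_const t (0 : ℂ)
    refine (hasDerivAt_polyKernel p s i (x - z) t ?_).smul_const (F x)
    rw [← hsub, sub_ne_zero]
    rintro rfl
    linarith [hzt t ht]

/-! ### Vanishing of all moments -/

/-- The Laplacian step: `Δ |w|^{-s} = s (s + 2 - d) |w|^{-s-2}`, so if the Riesz potential of
exponent `s` vanishes near the origin, then so does the one of exponent `s + 2`. -/
theorem MomentVanishes.one_add_two {d : ℕ} {F : EuclideanSpace ℝ (Fin d) → ℂ}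
    (hF : IsRapidlyDecaying F) {ρ : ℝ} (hρ : 0 < ρ) (hF0 : ∀ x, ‖x‖ < 2 * ρ → F x = 0)
    {s : ℝ} (h : MomentVanishes F ρ 1 s) (hs : s ≠ 0) (hsd : s + 2 - d ≠ 0) :
    MomentVanishes F ρ 1 (s + 2) := by
  have hX : ∀ i, MomentVanishes F ρ (MvPolynomial.X i) (s + 2) := by
    intro i z hz
    have := h.deriv hF hρ hF0 i hz
    simpa [polyKernel, hs] using this
  intro z hz
  have hi : ∀ i, (s + 2) • ∫ x, polyKernel (MvPolynomial.X i * MvPolynomial.X i) (s + 2 + 2)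
      (x - z) • F x = ∫ x, polyKernel 1 (s + 2) (x - z) • F x := by
    intro i
    simpa using (hX i).deriv hF hρ hF0 i hz
  have hsum : ∑ i, ∫ x, polyKernel (MvPolynomial.X i * MvPolynomial.X i) (s + 2 + 2)
      (x - z) • F x = ∫ x, polyKernel 1 (s + 2) (x - z) • F x := by
    rw [← integral_finsetSum _ fun i _ => hF.integrable_polyKernel_smul hρ hF0 _ _ hz]
    congr 1
    ext x
    rcases lt_or_ge ‖x‖ (2 * ρ) with hx | hx
    · simp [hF0 x hx]
    rw [← Finset.sum_smul]
    congr 1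
    have hpos : 0 < ‖x - z‖ := by
      have := norm_sub_norm_le x z
      linarith
    have hsq : ∑ i, (x - z) i * (x - z) i = ‖x - z‖ ^ (2 : ℝ) := by
      rw [Real.rpow_two, EuclideanSpace.real_norm_sq_eq]
      exact Finset.sum_congr rfl fun i _ => (sq _).symm
    simp only [polyKernel, map_mul, MvPolynomial.eval_X, map_one, one_mul]
    rw [← Finset.sum_mul, hsq, ← Real.rpow_add hpos]
    congr 1
    ring
  set A := ∫ x, polyKernel 1 (s + 2) (x - z) • F x
  have hA : (s + 2) • A = (d : ℝ) • A := by
    conv_lhs => rw [← hsum]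
    rw [Finset.smul_sum, Finset.sum_congr rfl fun i _ => hi i]
    simp
  rw [← sub_eq_zero, ← sub_smul] at hA
  exact (smul_eq_zero.1 hA).resolve_left hsd

theorem MomentVanishes.one_add_two_mul {d : ℕ} {F : EuclideanSpace ℝ (Fin d) → ℂ}
    (hF : IsRapidlyDecaying F) {ρ : ℝ} (hρ : 0 < ρ) (hF0 : ∀ x, ‖x‖ < 2 * ρ → F x = 0)
    {α : ℝ} (h : MomentVanishes F ρ 1 α) (hα0 : ∀ j : ℕ, α + 2 * j ≠ 0)
    (hαd : ∀ j : ℕ, α + 2 * j + 2 - d ≠ 0) (j : ℕ) :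
    MomentVanishes F ρ 1 (α + 2 * j) := by
  induction j with
  | zero => simpa using h
  | succ j ih =>
    have := ih.one_add_two hF hρ hF0 (hα0 j) (hαd j)
    have e : α + 2 * ((j + 1 : ℕ) : ℝ) = α + 2 * j + 2 := by push_cast; ring
    rwa [e]

/-- Differentiating `x^m |x|^{-α-2j}` in the direction `i` gives a combination of
`x^{m-e_i} |x|^{-α-2j}` and `x^{m+e_i} |x|^{-α-2j-2}`, the latter with the coefficient
`-(α + 2j) ≠ 0`. Hence all monomials of degree at most `j` are reached. -/
theorem MomentVanishes.monomial {d : ℕ} {F : EuclideanSpace ℝ (Fin d) → ℂ}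
    (hF : IsRapidlyDecaying F) {ρ : ℝ} (hρ : 0 < ρ) (hF0 : ∀ x, ‖x‖ < 2 * ρ → F x = 0)
    {α : ℝ} (h : ∀ j : ℕ, MomentVanishes F ρ 1 (α + 2 * j)) (hα0 : ∀ j : ℕ, α + 2 * j ≠ 0)
    (m : Fin d →₀ ℕ) {j : ℕ} (hj : m.degree ≤ j) (a : ℝ) :
    MomentVanishes F ρ (MvPolynomial.monomial m a) (α + 2 * j) := by
  induction hn : m.degree using Nat.strong_induction_on generalizing m j a with
  | _ n ih =>
    by_cases hm : m = 0
    · subst hm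
      intro z hz
      have := h j z hz
      simp only [polyKernel, map_one, one_mul] at this
      simp only [polyKernel, MvPolynomial.monomial_zero', MvPolynomial.eval_C, mul_smul]
      rw [integral_smul, this, smul_zero]
    obtain ⟨i, hi⟩ : ∃ i, m i ≠ 0 := by
      by_contra! hall
      exact hm (Finsupp.ext hall)
    obtain ⟨m', rfl⟩ : ∃ m', m = m' + Finsupp.single i 1 :=
      ⟨m - Finsupp.single i 1, (tsub_add_cancel_of_le (by simpa [Nat.one_le_iff_ne_zero])).symm⟩
    have hdeg : m'.degree + 1 = n := by simpa using hn
    obtain ⟨j, rfl⟩ : ∃ k, j = k + 1 := ⟨j - 1, by omega⟩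
    intro z hz
    have h1 := (ih m'.degree (by omega) m' (j := j) (by omega) a rfl).deriv hF hρ hF0 i hz
    have h2 : ∫ x, polyKernel (MvPolynomial.pderiv i (MvPolynomial.monomial m' a))
        (α + 2 * j) (x - z) • F x = 0 := by
      rw [MvPolynomial.pderiv_monomial]
      by_cases hi' : m' i = 0
      · simp [hi', polyKernel]
      have hle : Finsupp.single i 1 ≤ m' := by simpa [Nat.one_le_iff_ne_zero]
      have hd' : (m' - Finsupp.single i 1).degree + 1 = m'.degree := by
        conv_rhs => rw [← tsub_add_cancel_of_le hle]
        simp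
      exact ih _ (by omega) _ (by omega) _ rfl z hz
    rw [h2, smul_eq_zero, MvPolynomial.X, MvPolynomial.monomial_mul, one_mul,
      add_comm (Finsupp.single i 1)] at h1
    have e : α + 2 * ((j + 1 : ℕ) : ℝ) = α + 2 * j + 2 := by push_cast; ring
    rw [e]
    exact h1.resolve_left (hα0 j)

theorem polyKernel_monomial {d : ℕ} (m : Fin d →₀ ℕ) (a α : ℝ) {x : EuclideanSpace ℝ (Fin d)}
    (hx : x ≠ 0) :
    polyKernel (MvPolynomial.monomial m a) (α + 2 * m.degree) x =
      MvPolynomial.eval (fun i => ((‖x‖ ^ 2)⁻¹ • x) i) (MvPolynomial.monomial m a) *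
        ‖x‖ ^ (-α) := by
  have hpos : 0 < ‖x‖ := norm_pos_iff.2 hx
  have hr : ‖x‖ ^ (-(α + 2 * (m.degree : ℝ))) = ((‖x‖ ^ 2)⁻¹) ^ m.degree * ‖x‖ ^ (-α) := by
    rw [inv_pow, ← pow_mul, ← Real.rpow_natCast, ← Real.rpow_neg hpos.le, ← Real.rpow_add hpos]
    congr 1
    push_cast
    ring
  rw [polyKernel, hr]
  simp only [MvPolynomial.eval_monomial, PiLp.smul_apply, smul_eq_mul, mul_pow,
    Finsupp.prod, Finset.prod_mul_distrib, Finset.prod_pow_eq_pow_sum, Finsupp.degree_apply]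
  ring

/-- All moments of `|x|^{-α} F(x)` against polynomials in the inverted variable `x / |x|²`
vanish. -/
theorem MomentVanishes.integral_eval_inversion {d : ℕ} {F : EuclideanSpace ℝ (Fin d) → ℂ}
    (hF : IsRapidlyDecaying F) {ρ : ℝ} (hρ : 0 < ρ) (hF0 : ∀ x, ‖x‖ < 2 * ρ → F x = 0)
    {α : ℝ} (h : ∀ j : ℕ, MomentVanishes F ρ 1 (α + 2 * j)) (hα0 : ∀ j : ℕ, α + 2 * j ≠ 0)
    (p : MvPolynomial (Fin d) ℝ) :
    (Integrable fun x => MvPolynomial.eval (fun i => ((‖x‖ ^ 2)⁻¹ • x) i) p •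
      (‖x‖ ^ (-α) • F x)) ∧
    ∫ x, MvPolynomial.eval (fun i => ((‖x‖ ^ 2)⁻¹ • x) i) p • (‖x‖ ^ (-α) • F x) = 0 := by
  induction p using MvPolynomial.induction_on' with
  | monomial m a =>
    have hz : ‖(0 : EuclideanSpace ℝ (Fin d))‖ < ρ := by simpa
    have hi := hF.integrable_polyKernel_smul hρ hF0 (MvPolynomial.monomial m a)
      (α + 2 * m.degree) hz
    have h0 := MomentVanishes.monomial hF hρ hF0 h hα0 m le_rfl a 0 hz
    have e : ∀ x, polyKernel (MvPolynomial.monomial m a) (α + 2 * m.degree) (x - 0) • F x =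
        MvPolynomial.eval (fun i => ((‖x‖ ^ 2)⁻¹ • x) i) (MvPolynomial.monomial m a) •
          (‖x‖ ^ (-α) • F x) := by
      intro x
      by_cases hx : x = 0
      · subst hx
        simp [hF0 0 (by simpa using hρ)]
      rw [sub_zero, polyKernel_monomial m a α hx, mul_smul]
    simp only [e] at hi h0
    exact ⟨hi, h0⟩
  | add p q hp hq =>
    simp only [map_add, add_smul]
    exact ⟨hp.1.add hq.1, by rw [integral_add hp.1 hq.1, hp.2, hq.2, add_zero]⟩

/-! ### Density of polynomials in the inverted variable -/

/-- Polynomials are uniformly dense in the continuous functions on a compact set. -/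
theorem exists_mvPolynomial_near {d : ℕ} {φ : EuclideanSpace ℝ (Fin d) → ℝ} (hφ : Continuous φ)
    {K : Set (EuclideanSpace ℝ (Fin d))} (hK : IsCompact K) {ε : ℝ} (hε : 0 < ε) :
    ∃ p : MvPolynomial (Fin d) ℝ, ∀ u ∈ K, |MvPolynomial.eval (fun i => u i) p - φ u| < ε := by
  have : CompactSpace K := isCompact_iff_compactSpace.1 hK
  let X : Fin d → C(K, ℝ) := fun i => ⟨fun u => u.1 i, by fun_prop⟩
  have hev : ∀ (p : MvPolynomial (Fin d) ℝ) (u : K),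
      MvPolynomial.aeval X p u = MvPolynomial.eval (fun i => u.1 i) p := by
    intro p u
    induction p using MvPolynomial.induction_on with
    | C a => simp
    | add p q hp hq => simp [hp, hq]
    | mul_X p i hp => simp [hp, X]
  have hsep : (MvPolynomial.aeval (R := ℝ) X).range.SeparatesPoints := by
    intro u v huv
    obtain ⟨i, hi⟩ : ∃ i, u.1 i ≠ v.1 i := by
      by_contra! hall
      exact huv (Subtype.ext (PiLp.ext hall))
    exact ⟨X i, ⟨X i, ⟨MvPolynomial.X i, by simp⟩, rfl⟩, hi⟩
  obtain ⟨⟨g, p, rfl⟩, hg⟩ :=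
    ContinuousMap.exists_mem_subalgebra_near_continuous_of_separatesPoints
      (MvPolynomial.aeval (R := ℝ) X).range hsep (fun u : K => φ u)
      (hφ.comp continuous_subtype_val) ε hε
  refine ⟨p, fun u hu => ?_⟩
  rw [← hev p ⟨u, hu⟩]
  exact hg ⟨u, hu⟩

/-- Composition with the inversion `u ↦ u / |u|²`, where `0` is sent to `0`, preserves continuity
of a compactly supported function that vanishes at the origin. -/
theorem continuous_comp_inversion {d : ℕ} {h : EuclideanSpace ℝ (Fin d) → ℝ} (hc : Continuous h)
    (hs : HasCompactSupport h) (h0 : h 0 = 0) :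
    Continuous fun u : EuclideanSpace ℝ (Fin d) => h ((‖u‖ ^ 2)⁻¹ • u) := by
  rw [continuous_iff_continuousAt]
  intro u
  by_cases hu : u = 0
  · subst hu
    obtain ⟨R, hR0, hR⟩ := hs.isCompact.isBounded.exists_pos_norm_le
    have : (fun u : EuclideanSpace ℝ (Fin d) => h ((‖u‖ ^ 2)⁻¹ • u)) =ᶠ[nhds 0] fun _ => 0 := by
      filter_upwards [Metric.ball_mem_nhds (0 : EuclideanSpace ℝ (Fin d)) (inv_pos.2 hR0)] with u hu
      by_cases hu0 : u = 0
      · simp [hu0, h0]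
      by_contra hne
      have h1 := hR _ (subset_tsupport h hne)
      have hpos : 0 < ‖u‖ := norm_pos_iff.2 hu0
      have h2 : ‖(‖u‖ ^ 2)⁻¹ • u‖ = ‖u‖⁻¹ := by
        rw [norm_smul, norm_inv, norm_pow, norm_norm]
        field_simp
      rw [h2] at h1
      have h3 : ‖u‖ < R⁻¹ := by simpa using hu
      have := (inv_le_comm₀ hpos hR0).1 h1
      linarith
    exact continuousAt_const.congr this.symm
  · have : ‖u‖ ^ 2 ≠ 0 := by simpa using hu
    refine ContinuousAt.comp (g := h) hc.continuousAt ?_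
    exact ((continuous_norm.pow 2).continuousAt.inv₀ this).smul continuousAt_id

/-- **Unique continuation for rapidly decaying functions**: if `F` and all its Riesz potentials of
exponents `α + 2j` vanish near the origin, then `F = 0`. -/
theorem IsRapidlyDecaying.eq_zero {d : ℕ} {F : EuclideanSpace ℝ (Fin d) → ℂ}
    (hF : IsRapidlyDecaying F) {ρ : ℝ} (hρ : 0 < ρ) (hF0 : ∀ x, ‖x‖ < 2 * ρ → F x = 0)
    {α : ℝ} (h : ∀ j : ℕ, MomentVanishes F ρ 1 (α + 2 * j)) (hα0 : ∀ j : ℕ, α + 2 * j ≠ 0) :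
    F = 0 := by
  set G : EuclideanSpace ℝ (Fin d) → ℂ := fun x => ‖x‖ ^ (-α) • F x
  have hmom := MomentVanishes.integral_eval_inversion hF hρ hF0 h hα0
  have hG : Integrable G := by
    have := (hmom 1).1
    simp only [map_one, one_smul] at this
    exact this
  have key : ∀ g : EuclideanSpace ℝ (Fin d) → ℝ, Continuous g → HasCompactSupport g → g 0 = 0 →
      ∫ x, g x • G x = 0 := by
    intro g hg hgs hg0
    have hgG : Integrable fun x => g x • G x := by
      obtain ⟨C, hC⟩ := hgs.exists_bound_of_continuous hg
      exact hG.bdd_smul C hg.aestronglyMeasurable (Filter.Eventually.of_forall hC)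
    have hle : ∀ ε : ℝ, 0 < ε → ‖∫ x, g x • G x‖ ≤ ε * ∫ x, ‖G x‖ := by
      intro ε hε
      -- `|x| ≥ 2ρ` on the support of `G`, so the inverted variable stays in a fixed ball
      obtain ⟨p, hp⟩ := exists_mvPolynomial_near (continuous_comp_inversion hg hgs hg0)
        (isCompact_closedBall (0 : EuclideanSpace ℝ (Fin d)) (2 * ρ)⁻¹) hε
      rw [← norm_neg, ← zero_sub, ← (hmom p).2, ← integral_sub (hmom p).1 hgG,
        ← integral_const_mul]
      refine norm_integral_le_of_norm_le (hG.norm.const_mul ε)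
        (Filter.Eventually.of_forall fun x => ?_)
      rcases lt_or_ge ‖x‖ (2 * ρ) with hx | hx
      · simp [G, hF0 x hx]
      have hpos : 0 < ‖x‖ := by linarith
      have hinv : ‖(‖x‖ ^ 2)⁻¹ • x‖ = ‖x‖⁻¹ := by
        rw [norm_smul, norm_inv, norm_pow, norm_norm]
        field_simp
      have hu := hp ((‖x‖ ^ 2)⁻¹ • x) (by
        rw [mem_closedBall_zero_iff, hinv]
        gcongr)
      -- the inversion is an involution
      have hx2 : (‖(‖x‖ ^ 2)⁻¹ • x‖ ^ 2)⁻¹ • (‖x‖ ^ 2)⁻¹ • x = x := by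
        rw [hinv, smul_smul]
        convert one_smul ℝ x using 2
        field_simp
      simp only [hx2] at hu
      rw [← sub_smul, norm_smul, Real.norm_eq_abs]
      gcongr
    by_contra hne
    have hpos : 0 < ‖∫ x, g x • G x‖ := norm_pos_iff.2 hne
    have hI : 0 ≤ ∫ x, ‖G x‖ := integral_nonneg fun x => norm_nonneg _
    have := hle (‖∫ x, g x • G x‖ / (2 * (1 + ∫ x, ‖G x‖))) (by positivity)
    rw [div_mul_eq_mul_div, le_div_iff₀ (by positivity)] at this
    nlinarith
  have hae : ∀ᵐ x, x ∈ ({0}ᶜ : Set (EuclideanSpace ℝ (Fin d))) → G x = 0 :=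
    isOpen_compl_singleton.ae_eq_zero_of_integral_contDiff_smul_eq_zero
      (hG.locallyIntegrable.locallyIntegrableOn _) fun g hg hgs hgt =>
        key g hg.continuous hgs (image_eq_zero_of_notMem_tsupport fun h0 => hgt h0 rfl)
  have hFae : F =ᵐ[volume] 0 := by
    filter_upwards [hae] with x hx
    by_cases hx0 : x = 0
    · subst hx0
      simpa using hF0 0 (by simpa using hρ)
    · have hpos : 0 < ‖x‖ := norm_pos_iff.2 hx0
      exact (smul_eq_zero.1 (hx hx0)).resolve_left (Real.rpow_pos_of_pos hpos _).ne'
  exact hF.continuous.ae_eq_iff_eq volume continuous_zero |>.1 hFae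

/-! ### Mollification of rapidly decreasing distributions -/

theorem isRapidlyDecaying_pairTranslate {d : ℕ} {f : 𝓢'(EuclideanSpace ℝ (Fin d), ℂ)}
    (hf : IsRapidlyDecreasing f) (φ : 𝓢(EuclideanSpace ℝ (Fin d), ℂ)) :
    IsRapidlyDecaying (pairTranslate f φ) where
  continuous := (pairTranslate_bound hf 0).1 φ
  decay K := by
    obtain ⟨-, s, D, -, hD⟩ := pairTranslate_bound hf K
    exact ⟨_, hD φ⟩

theorem pairTranslate_compSubConstCLM {d : ℕ} (f : 𝓢'(EuclideanSpace ℝ (Fin d), ℂ))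
    (φ : 𝓢(EuclideanSpace ℝ (Fin d), ℂ)) (x z : EuclideanSpace ℝ (Fin d)) :
    pairTranslate f (φ.compSubConstCLM ℂ (-z)) x = pairTranslate f φ (x + z) := by
  unfold pairTranslate
  congr 1
  ext y
  simp

theorem VanishesOn.apply_translate {d : ℕ} {f : 𝓢'(EuclideanSpace ℝ (Fin d), ℂ)}
    {V : Set (EuclideanSpace ℝ (Fin d))} (hfV : VanishesOn f V)
    {c x : EuclideanSpace ℝ (Fin d)} {r ρ : ℝ} (hcV : Metric.ball c r ⊆ V)
    {ψ : 𝓢(EuclideanSpace ℝ (Fin d), ℂ)} (hψ : HasCompactSupport ψ)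
    (hψc : tsupport ψ ⊆ Metric.ball c ρ) (hx : ρ + ‖x‖ ≤ r) :
    f (ψ.compSubConstCLM ℂ (-x)) = 0 := by
  have e : (ψ.compSubConstCLM ℂ (-x) : EuclideanSpace ℝ (Fin d) → ℂ) =
      ψ ∘ Homeomorph.addRight x := by
    ext y
    simp
  refine hfV _ ?_ ?_
  · rw [e]
    exact hψ.comp_homeomorph _
  · rw [e, tsupport_comp_eq_preimage]
    intro y hy
    refine hcV ?_
    have := hψc hy
    simp only [Homeomorph.coe_addRight, Metric.mem_ball, dist_eq_norm] at this ⊢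
    calc ‖y - c‖ = ‖(y + x - c) - x‖ := by congr 1; abel
      _ ≤ ‖y + x - c‖ + ‖x‖ := norm_sub_le _ _
      _ < r := by linarith

/-- If `f` and its Riesz potential vanish on a ball, then `f` vanishes on all translates of test
functions supported in a smaller concentric ball. -/
theorem pairTranslate_eq_zero {d : ℕ} {α : ℝ} (hαd : α < d)
    {f : 𝓢'(EuclideanSpace ℝ (Fin d), ℂ)} (hf : IsRapidlyDecreasing f)
    (hα0 : ∀ j : ℕ, α + 2 * j ≠ 0) (hαd' : ∀ j : ℕ, α + 2 * j + 2 - d ≠ 0)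
    {V : Set (EuclideanSpace ℝ (Fin d))} (hfV : VanishesOn f V)
    (hIV : VanishesOn (rieszPotential hαd f hf) V) {c : EuclideanSpace ℝ (Fin d)} {ρ : ℝ}
    (hρ : 0 < ρ) (hcV : Metric.ball c (3 * ρ) ⊆ V) {ψ : 𝓢(EuclideanSpace ℝ (Fin d), ℂ)}
    (hψ : HasCompactSupport ψ) (hψc : tsupport ψ ⊆ Metric.ball c ρ) :
    pairTranslate f ψ = 0 := by
  have hF := isRapidlyDecaying_pairTranslate hf ψ
  have hF0 : ∀ x, ‖x‖ < 2 * ρ → pairTranslate f ψ x = 0 := fun x hx =>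
    hfV.apply_translate hcV hψ hψc (by linarith)
  have h1 : MomentVanishes (pairTranslate f ψ) ρ 1 α := by
    intro z hz
    have := hIV.apply_translate hcV hψ hψc (x := z) (by linarith)
    rw [rieszPotential_apply] at this
    simp only [pairTranslate_compSubConstCLM] at this
    rw [← integral_sub_right_eq_self _ z] at this
    simpa [polyKernel, rieszKernel] using this
  exact hF.eq_zero hρ hF0 (h1.one_add_two_mul hF hρ hF0 hα0 hαd') hα0

/-! ### Recovering a distribution from its mollifications -/

/-- The reflection `φ(-·)` of a Schwartz function. -/
noncomputable def schwartzReflect {d : ℕ} :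
    𝓢(EuclideanSpace ℝ (Fin d), ℂ) →L[ℂ] 𝓢(EuclideanSpace ℝ (Fin d), ℂ) :=
  SchwartzMap.compCLMOfContinuousLinearEquiv ℂ (ContinuousLinearEquiv.neg ℝ)

theorem schwartzReflect_apply {d : ℕ} (φ : 𝓢(EuclideanSpace ℝ (Fin d), ℂ))
    (x : EuclideanSpace ℝ (Fin d)) : schwartzReflect φ x = φ (-x) := by
  simp [schwartzReflect]

theorem iteratedLineDerivOp_schwartzReflect {d n : ℕ} (m : Fin n → EuclideanSpace ℝ (Fin d))
    (φ : 𝓢(EuclideanSpace ℝ (Fin d), ℂ)) (x : EuclideanSpace ℝ (Fin d)) :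
    (∂^{m} (schwartzReflect φ)) x = (-1) ^ n * (∂^{m} φ) (-x) := by
  rw [SchwartzMap.iteratedLineDerivOp_eq_iteratedFDeriv,
    SchwartzMap.iteratedLineDerivOp_eq_iteratedFDeriv]
  have : (schwartzReflect φ : EuclideanSpace ℝ (Fin d) → ℂ) = fun z => φ ((-1 : ℝ) • z) := by
    ext z
    simp [schwartzReflect_apply]
  rw [this, iteratedFDeriv_comp_const_smul (-1 : ℝ) (φ.smooth n)]
  simp

theorem lineDerivOp_lineDerivOp_comm {d : ℕ} (a b : EuclideanSpace ℝ (Fin d))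
    (φ : 𝓢(EuclideanSpace ℝ (Fin d), ℂ)) : ∂_{a} (∂_{b} φ) = ∂_{b} (∂_{a} φ) := by
  have h : ∀ (v w x : EuclideanSpace ℝ (Fin d)),
      (∂_{v} (∂_{w} φ)) x = fderiv ℝ (fderiv ℝ φ) x v w := by
    intro v w x
    have := SchwartzMap.iteratedLineDerivOp_eq_iteratedFDeriv (m := ![v, w]) (f := φ) (x := x)
    rw [iteratedFDeriv_two_apply] at this
    exact this
  ext x
  rw [h, h]
  exact (φ.smooth 2).contDiffAt.isSymmSndFDerivAt (by simp) a b

theorem iteratedLineDerivOp_lineDerivOp_comm {d n : ℕ} (m : Fin n → EuclideanSpace ℝ (Fin d))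
    (a : EuclideanSpace ℝ (Fin d)) (φ : 𝓢(EuclideanSpace ℝ (Fin d), ℂ)) :
    ∂^{m} (∂_{a} φ) = ∂_{a} (∂^{m} φ) := by
  induction n with
  | zero => simp
  | succ n ih =>
    rw [LineDeriv.iteratedLineDerivOp_succ_left, ih, lineDerivOp_lineDerivOp_comm,
      ← LineDeriv.iteratedLineDerivOp_succ_left]

theorem integral_mul_iteratedLineDerivOp {d n : ℕ} (m : Fin n → EuclideanSpace ℝ (Fin d))
    (φ ψ : 𝓢(EuclideanSpace ℝ (Fin d), ℂ)) :
    ∫ x, φ x * (∂^{m} ψ) x = (-1) ^ n * ∫ x, (∂^{m} φ) x * ψ x := by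
  induction n generalizing φ with
  | zero => simp
  | succ n ih =>
    rw [LineDeriv.iteratedLineDerivOp_succ_left,
      SchwartzMap.integral_mul_lineDerivOp_right_eq_neg_left, ih,
      iteratedLineDerivOp_lineDerivOp_comm, ← LineDeriv.iteratedLineDerivOp_succ_left]
    ring

theorem integral_mul_integral_mul_swap {d : ℕ} {φ g : EuclideanSpace ℝ (Fin d) → ℂ}
    (hφ : Integrable φ) (hg : Integrable g)
    {h : EuclideanSpace ℝ (Fin d) → EuclideanSpace ℝ (Fin d) → ℂ}
    (hh : Continuous (Function.uncurry h)) {C : ℝ} (hC : ∀ x y, ‖h x y‖ ≤ C) :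
    ∫ x, φ x * ∫ y, g y * h x y = ∫ y, g y * ∫ x, φ x * h x y := by
  have hint : Integrable (Function.uncurry fun x y => φ x * (g y * h x y))
      (volume.prod volume) := by
    have := (hφ.mul_prod hg).mul_bdd (c := C) hh.aestronglyMeasurable
      (Filter.Eventually.of_forall fun z => hC z.1 z.2)
    refine this.congr (Filter.Eventually.of_forall fun z => ?_)
    simp only [Function.uncurry, mul_assoc]
  simp only [← integral_const_mul]
  rw [integral_integral_swap hint]
  simp only [mul_left_comm]

/-- Both sides are the integral of `g` against the iterated derivative, in the directions `m`, of
the convolution of `φ(-·)` and `ψ`; integration by parts moves the derivative from one factor to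
the other. -/
theorem integral_mul_integral_mul_iteratedLineDerivOp {d n : ℕ}
    (m : Fin n → EuclideanSpace ℝ (Fin d)) {g : EuclideanSpace ℝ (Fin d) → ℂ}
    (hg : Integrable g) (φ ψ : 𝓢(EuclideanSpace ℝ (Fin d), ℂ)) :
    ∫ x, φ x * ∫ y, g y * (∂^{m} ψ) (y + x) =
      ∫ x, ψ x * ∫ y, g y * (∂^{m} (schwartzReflect φ)) (y - x) := by
  have c₁ := (∂^{m} ψ).continuous
  have c₂ := (∂^{m} (schwartzReflect φ)).continuous
  rw [integral_mul_integral_mul_swap φ.integrable hg (h := fun x y => (∂^{m} ψ) (y + x))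
      (by unfold Function.uncurry; fun_prop)
      (fun x y => SchwartzMap.norm_le_seminorm ℂ (∂^{m} ψ) (y + x)),
    integral_mul_integral_mul_swap ψ.integrable hg
      (h := fun x y => (∂^{m} (schwartzReflect φ)) (y - x))
      (by unfold Function.uncurry; fun_prop)
      (fun x y => SchwartzMap.norm_le_seminorm ℂ (∂^{m} (schwartzReflect φ)) (y - x))]
  congr 1
  ext y
  congr 1
  have hibp := integral_mul_iteratedLineDerivOp m φ (ψ.compSubConstCLM ℂ (-y))
  have hψ : ∀ x, (∂^{m} (ψ.compSubConstCLM ℂ (-y))) x = (∂^{m} ψ) (y + x) := fun x => by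
    rw [iteratedLineDerivOp_compSubConstCLM, add_comm]
  simp only [hψ, iteratedLineDerivOp_schwartzReflect] at hibp ⊢
  rw [hibp, ← integral_sub_right_eq_self _ y, ← integral_const_mul]
  congr 1
  ext x
  simp only [SchwartzMap.compSubConstCLM_apply, neg_sub, sub_neg_eq_add, sub_add_cancel]
  ring

/-- Both sides are `f` applied to the convolution of `φ(-·)` and `ψ`. -/
theorem integral_mul_pairTranslate {d : ℕ} {f : 𝓢'(EuclideanSpace ℝ (Fin d), ℂ)}
    (hf : IsRapidlyDecreasing f) (φ ψ : 𝓢(EuclideanSpace ℝ (Fin d), ℂ)) :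
    ∫ x, φ x * pairTranslate f ψ x = ∫ x, ψ x * pairTranslate f (schwartzReflect φ) (-x) := by
  obtain ⟨N, n, β, g, hg, hC, hfg⟩ := hf (d + 1)
  choose C hC using hC
  have hgi := fun i => integrable_of_one_add_norm_pow_mul_le (hg i) (hC i)
  have hval : ∀ χ x, pairTranslate f χ x = ∑ i, (-1 : ℂ) ^ n i *
      ∫ y, g i y * (∂^{fun j => EuclideanSpace.single (β i j) (1 : ℝ)} χ) (y + x) := by
    intro χ x
    simp only [pairTranslate, hfg, iteratedLineDerivOp_compSubConstCLM]
  have hint : ∀ (χ χ' : 𝓢(EuclideanSpace ℝ (Fin d), ℂ)) i, Integrable fun x => χ x *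
      ∫ y, g i y * (∂^{fun j => EuclideanSpace.single (β i j) (1 : ℝ)} χ') (y + x) := by
    intro χ χ' i
    obtain ⟨hc, D, hD0, hD⟩ := term_bound (β i) 0 (hg i) (C := C i) (by simpa using hC i)
    refine χ.integrable.mul_bdd
      (c := D * (Finset.Iic (0, n i)).sup (schwartzSeminormFamily ℂ _ ℂ) χ') (hc χ').aestronglyMeasurable
      (Filter.Eventually.of_forall fun x => ?_)
    simpa using hD χ' x
  have hint' : ∀ i, Integrable fun x => ψ x * ∫ y, g i y *
      (∂^{fun j => EuclideanSpace.single (β i j) (1 : ℝ)} (schwartzReflect φ)) (y + -x) := by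
    intro i
    have := (hint (schwartzReflect ψ) (schwartzReflect φ) i).comp_neg
    simpa only [schwartzReflect_apply, neg_neg] using this
  simp only [hval, Finset.mul_sum, mul_left_comm _ ((-1 : ℂ) ^ _)]
  rw [integral_finsetSum _ fun i _ => (hint φ ψ i).const_mul _,
    integral_finsetSum _ fun i _ => (hint' i).const_mul _]
  refine Finset.sum_congr rfl fun i _ => ?_
  rw [integral_const_mul, integral_const_mul,
    integral_mul_integral_mul_iteratedLineDerivOp _ (hgi i)]
  simp only [sub_eq_add_neg]

/-- A rapidly decreasing distribution whose mollifications by all test functions supported in some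
fixed ball vanish is zero. -/
theorem eq_zero_of_pairTranslate_eq_zero {d : ℕ} {f : 𝓢'(EuclideanSpace ℝ (Fin d), ℂ)}
    (hf : IsRapidlyDecreasing f) {c : EuclideanSpace ℝ (Fin d)} {ρ : ℝ} (hρ : 0 < ρ)
    (h : ∀ ψ : 𝓢(EuclideanSpace ℝ (Fin d), ℂ), HasCompactSupport ψ →
      tsupport ψ ⊆ Metric.ball c ρ → pairTranslate f ψ = 0) : f = 0 := by
  -- `x ↦ ⟨f, χ(· - x)⟩` is orthogonal to all test functions on the ball, and it is continuous
  have key : ∀ χ : 𝓢(EuclideanSpace ℝ (Fin d), ℂ), pairTranslate f χ (-c) = 0 := by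
    intro χ
    set H : EuclideanSpace ℝ (Fin d) → ℂ := fun x => pairTranslate f χ (-x)
    have hH : Continuous H := ((pairTranslate_bound hf 0).1 χ).comp continuous_neg
    have hae : ∀ᵐ x, x ∈ Metric.ball c ρ → H x = 0 := by
      refine Metric.isOpen_ball.ae_eq_zero_of_integral_contDiff_smul_eq_zero
        (hH.locallyIntegrable.locallyIntegrableOn _) fun g hg hgs hgt => ?_
      have hgs' : HasCompactSupport (Complex.ofRealCLM ∘ g) := hgs.comp_left rfl
      let ψ := hgs'.toSchwartzMap (Complex.ofRealCLM.contDiff.comp hg)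
      have hψt : tsupport ψ ⊆ Metric.ball c ρ :=
        (closure_mono fun x hx => by
          intro hx0
          exact hx (by simp [ψ, hx0])).trans hgt
      have := integral_mul_pairTranslate hf (schwartzReflect χ) ψ
      have hrr : schwartzReflect (schwartzReflect χ) = χ := by
        ext x
        simp [schwartzReflect_apply]
      rw [h ψ hgs' hψt, hrr] at this
      simpa [ψ] using this.symm
    have hEq : Set.EqOn H 0 (Metric.ball c ρ) := by
      refine Measure.eqOn_open_of_ae_eq (μ := volume) ?_ Metric.isOpen_ball hH.continuousOn
        continuousOn_const
      exact (ae_restrict_iff' measurableSet_ball).2 hae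
    exact hEq (Metric.mem_ball_self hρ)
  ext φ
  have := key (φ.compSubConstCLM ℂ (-c))
  rw [pairTranslate_compSubConstCLM, neg_add_cancel] at this
  simpa [pairTranslate, SchwartzMap.compSubConstCLM_zero] using this

/-! ### Unique continuation for Riesz potentials -/

theorem mainTheorem5 (d : ℕ) (hd : 2 ≤ d) (α : ℝ) (hαd : α < d)
    (hα : α = d - 1 ∨ ∀ n : ℤ, α ≠ n)
    (f : 𝓢'(EuclideanSpace ℝ (Fin d), ℂ)) (hf : IsRapidlyDecreasing f)
    (V : Set (EuclideanSpace ℝ (Fin d))) (hV : IsOpen V) (hVne : V.Nonempty)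
    (hfV : VanishesOn f V) (hIV : VanishesOn (rieszPotential hαd f hf) V) :
    f = 0 := by
  obtain ⟨c, hc⟩ := hVne
  obtain ⟨r, hr, hrV⟩ := Metric.isOpen_iff.1 hV c hc
  have hα0 : ∀ j : ℕ, α + 2 * j ≠ 0 := by
    intro j hj
    rcases hα with h | h
    · have : (2 : ℝ) ≤ d := by exact_mod_cast hd
      have : (0 : ℝ) ≤ j := j.cast_nonneg
      linarith
    · exact h (-2 * j) (by push_cast; linarith)
  have hαd' : ∀ j : ℕ, α + 2 * j + 2 - d ≠ 0 := by
    intro j hj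
    rcases hα with h | h
    · have : (0 : ℝ) ≤ j := j.cast_nonneg
      linarith
    · exact h (d - 2 - 2 * j) (by push_cast; linarith)
  have hρ : 0 < r / 3 := by positivity
  exact eq_zero_of_pairTranslate_eq_zero hf hρ fun ψ hψ hψc =>
    pairTranslate_eq_zero hαd hf hα0 hαd' hfV hIV hρ
      (by rwa [mul_div_cancel₀ r (by norm_num : (3 : ℝ) ≠ 0)]) hψ hψc
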